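/- **Setting.** A stochastic shortest path (SSP) instance consists of non-target states $1,\dots,n$, an absorbing target state $0$, actions $1,\dots,m$, each available in exactly one state, a row substochastic matrix $P\in\mathbb R^{m\times n}$ ($P(a,s)$ is the probability of moving to $s$ under action $a$; the missing mass $1-\sum_s P(a,s)$ is the probability of moving to $0$), and costs $c\in\mathbb R^m$. Let $J\in\{0,1\}^{m\times n}$ with $J(a,s)=1$ iff $a$ is available in $s$. The SSP linear program and its dual are $$(P)\quad \min\{c^Tx : (J-P)^Tx=\mathbf 1,\ x\ge 0\},\qquad (D)\quad \max\{\mathbf 1^Ty : (J-P)y\le c\}.$$ The support graph has arcs from each state to its available actions, and from each action to the states (including $0$) to which it leads with positive probability. A deterministic stationary policy $\Pi$ chooses one available action in each state; it is proper if, from every initial state, the sum over all periods of the vectors of action probabilities is finite. With $P_\Pi$, $c_\Pi$ the rows of $P$ and $c$ for the chosen actions, a proper $\Pi$ has flux $x^\Pi=(I-P_\Pi)^{-T}\mathbf 1$ (extended by zero to the other actions), dual solution $y^\Pi=(I-P_\Pi)^{-1}c_\Pi$ and reduced costs $c-(J-P)y^\Pi$. A step of Howard's policy iteration switches, in every state where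 an action of negative reduced cost is available, to such an action, and keeps the action elsewhere; a step of simple policy iteration switches to an action of negative reduced cost in exactly one state (with any pivot rule). Both stop when no reduced cost is negative. **Primal-dual algorithm.** Given a feasible $\bar y$ of (D), let $\bar{\mathcal A}=\{a: ((J-P)\bar y)_a=c_a\}$. The MAXPROB subproblem is the SSP instance whose actions are those in $\bar{\mathcal A}$, with cost $0$, and, for each state $k=1,\dots,n$, an artificial action of cost $1$ leading from $k$ to $0$ with probability one. Its linear program is (RP) $\min\{\mathbf 1^Tz : (J_{\bar{\mathcal A}}-P_{\bar{\mathcal A}})^Tx+z=\mathbf 1,\ x,z\ge 0\}$, with dual (DRP) $\max\{\mathbf 1^Ty: (J_{\bar{\mathcal A}}-P_{\bar{\mathcal A}})y\le 0,\ y\le\mathbf 1\}$. Solve it by policy iteration started at any proper policy of the subproblem. Let $\Pi$ be the final policy. If the cost of $x^\Pi$ in (RP) is $0$, stop; otherwise replace $\bar y$ by $\bar y+\epsilon\,y^\Pi$, where $\epsilon\ge0$ is maximum such that this vector is feasible for (D), and iterate. **Theorem.** Assume that in the support graph there is a path from every state to $0$, and that $c\ge 0$. Then $\bar y=0$ is feasible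 for (D), so that the primal-dual algorithm can be initialized with $\bar y=0$. If the subproblems are solved by Howard's policy iteration, or by simple policy iteration with any pivot rule, then: 1. The algorithm terminates after finitely many steps: for each instance there is a bound on the total number of steps (policy iteration steps and dual updates) of all its runs, and no run gets stuck before the stopping test succeeds (in particular the maximum $\epsilon$ always exists). 2. Along each run $\bar y$ is feasible for (D), and policy iteration produces only proper policies and ends with optimal solutions $x^\Pi$ of (RP) and $y^\Pi$ of (DRP). When the algorithm stops, the $\bar{\mathcal A}$-part of $x^\Pi$, extended by zero, is optimal for (P), and $\bar y$ is optimal for (D). 3. The algorithm generalizes Dijkstra's algorithm: suppose that $P$ is a $0/1$ matrix (a deterministic instance). Say that $\bar y$ labels a state $s$, with label $\bar y(s)$, if $s$ is connected to $0$ in the support graph restricted to $\bar{\mathcal A}$. Then the labels given by $\bar y=0$ are obtained from the empty labelling by finitely many (possibly zero) steps of Dijkstra's algorithm towards $0$ (each step labels permanently one unlabelled state whose tentative label is smallest), each dual update made in a run changes the labels by a finite, nonzero number of such steps, and on termination every state $s$ is labelled with $\bar y(s)$. -/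

import Mathlib

open Matrix

noncomputable section

/-- A stochastic shortest path instance. `σ` is the set of the non-target states `1, …, n` and `α`
the set of the actions `1, …, m`; the target state and its unique action are implicit, as in the
matrices `J` and `P`. Every action is available in exactly one state, `src a`. The entry `P a s` is
the probability of moving to `s` when taking action `a`; the missing mass `1 - ∑ s, P a s` is the
probability of moving to the target. -/
structure SSP (σ α : Type*) [Fintype σ] where
  src : α → σ
  P : Matrix α σ ℝ
  P_nonneg : ∀ a s, 0 ≤ P a s
  P_row_le_one : ∀ a, ∑ s, P a s ≤ 1
  c : α → ℝ

namespace SSP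

variable {σ α : Type*} [Fintype σ]

/-! ### The support graph -/

/-- The arcs of the support graph. Its vertices are the states (`Sum.inl`) and the actions
(`Sum.inr`); `none` stands for the target state and for its action. -/
inductive Arc (M : SSP σ α) : Option σ ⊕ Option α → Option σ ⊕ Option α → Prop
  | stateAction (a : α) : Arc M (Sum.inl (some (M.src a))) (Sum.inr (some a))
  | actionState (a : α) (s : σ) : 0 < M.P a s → Arc M (Sum.inr (some a)) (Sum.inl (some s))
  | actionTarget (a : α) : ∑ s, M.P a s < 1 → Arc M (Sum.inr (some a)) (Sum.inl none)
  | targetOut : Arc M (Sum.inl none) (Sum.inr none)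
  | targetIn : Arc M (Sum.inr none) (Sum.inl none)

/-- There is a path from state `s` to the target state in the support graph. -/
def ReachesTarget (M : SSP σ α) (s : σ) : Prop :=
  Relation.ReflTransGen M.Arc (Sum.inl (some s)) (Sum.inl none)

/-- The instance with the same states, where only the actions in `A` are kept. -/
def keep (M : SSP σ α) (A : Set α) : SSP σ A where
  src a := M.src a
  P := Matrix.of fun a s => M.P a s
  P_nonneg a s := M.P_nonneg a s
  P_row_le_one a := M.P_row_le_one a
  c a := M.c a

/-- The instance `MAXPROB` on the action set `A ∪ {m+1, …, m+n}`: the actions in `A` cost zero, and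
each state `s` has an artificial action `Sum.inr s`, of cost one, which leads to the target with
probability one. Its linear program `(P)` is the restricted primal
`min 1ᵀz` subject to `(J_A - P_A)ᵀ x_A + z = 1`, `x_A, z ≥ 0`, and its dual `(D)` is
`max 1ᵀy` subject to `(J_A - P_A) y ≤ 0`, `y ≤ 1`. -/
def maxprob (M : SSP σ α) (A : Set α) : SSP σ (A ⊕ σ) where
  src := Sum.elim (fun a => M.src a) id
  P := Matrix.of fun a s => Sum.elim (fun a : A => M.P a s) (fun _ => 0) a
  P_nonneg a s := by
    rcases a with a | t
    · exact M.P_nonneg a s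
    · exact le_rfl
  P_row_le_one a := by
    rcases a with a | t
    · exact M.P_row_le_one a
    · simp
  c := Sum.elim (fun _ => 0) (fun _ => 1)

/-- A deterministic and stationary policy. -/
structure Policy (M : SSP σ α) where
  act : σ → α
  src_act : ∀ s, M.src (act s) = s

/-- Deterministic instances: `P` is a 0/1 matrix, so that each action is an arc from `src a` to one
state or to the target. -/
def Deterministic (M : SSP σ α) : Prop := ∀ a s, M.P a s = 0 ∨ M.P a s = 1

variable [DecidableEq σ]

/-- The 0/1 matrix of available actions. -/
def J (M : SSP σ α) : Matrix α σ ℝ := Matrix.of fun a s => if M.src a = s then 1 else 0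

/-! ### The linear programs (P) and (D) -/

/-- `x` is feasible for `(P)`: `min cᵀx` subject to `(J - P)ᵀ x = 1`, `x ≥ 0`. -/
def PrimalFeasible [Fintype α] (M : SSP σ α) (x : α → ℝ) : Prop :=
  (M.J - M.P)ᵀ *ᵥ x = 1 ∧ 0 ≤ x

def PrimalOptimal [Fintype α] (M : SSP σ α) (x : α → ℝ) : Prop :=
  M.PrimalFeasible x ∧ ∀ x', M.PrimalFeasible x' → M.c ⬝ᵥ x ≤ M.c ⬝ᵥ x'

/-- `y` is feasible for `(D)`: `max 1ᵀy` subject to `(J - P) y ≤ c`. -/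
def DualFeasible (M : SSP σ α) (y : σ → ℝ) : Prop :=
  (M.J - M.P) *ᵥ y ≤ M.c

def DualOptimal (M : SSP σ α) (y : σ → ℝ) : Prop :=
  M.DualFeasible y ∧ ∀ y', M.DualFeasible y' → ∑ s, y' s ≤ ∑ s, y s

/-- The set of the actions whose dual constraint is tight at `y`. -/
def tight (M : SSP σ α) (y : σ → ℝ) : Set α :=
  {a | ((M.J - M.P) *ᵥ y) a = M.c a}

/-! ### Deterministic and stationary policies, and policy iteration -/

namespace Policy

variable {M : SSP σ α}

/-- The `n × n` matrix obtained from `P` by keeping the rows of the actions in the policy. -/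
def transition (π : M.Policy) : Matrix σ σ ℝ := Matrix.of fun s t => M.P (π.act s) t

/-- The cost vector restricted to the actions in the policy. -/
def actCost (π : M.Policy) : σ → ℝ := fun s => M.c (π.act s)

/-- `y_k`: the distribution over the non-target states at time `k`, starting from `y₀`. -/
def stateDist (π : M.Policy) (y₀ : σ → ℝ) (k : ℕ) : σ → ℝ :=
  (π.transitionᵀ ^ k) *ᵥ y₀

open Classical in
/-- The vector over actions that puts the mass `w s` on the action chosen in state `s`. -/
def lift (π : M.Policy) (w : σ → ℝ) : α → ℝ :=
  fun a => if π.act (M.src a) = a then w (M.src a) else 0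

/-- The policy is proper: from every initial state `s`, the series `∑ k, x_k` of the vectors of
action probabilities is finite. -/
def Proper (π : M.Policy) : Prop :=
  ∀ s : σ, Summable fun k : ℕ => π.lift (π.stateDist (Pi.single s 1) k)

/-- The basic solution `(I - P_π)^{-T} 1` of `(P)` associated with a (proper) policy, as a vector
over the actions. -/
def flux (π : M.Policy) : α → ℝ :=
  π.lift ((1 - π.transition)ᵀ⁻¹ *ᵥ 1)

/-- The dual solution `c_π (I - P_π)^{-T}` associated with a (proper) policy. -/
def dual (π : M.Policy) : σ → ℝ :=
  (1 - π.transition)⁻¹ *ᵥ π.actCost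

/-- The reduced costs `c - c_π (I - P_π)^{-T} (J - P)ᵀ`. -/
def reducedCost (π : M.Policy) : α → ℝ :=
  M.c - (M.J - M.P) *ᵥ π.dual

/-- An action with negative reduced cost. -/
def Improving (π : M.Policy) (a : α) : Prop := π.reducedCost a < 0

/-- An iteration of Howard's policy iteration: in each state where an improving action is
available, switch to such an action; keep the current action in all the other states. -/
def HowardStep (π π' : M.Policy) : Prop :=
  (∃ a, π.Improving a) ∧
    ∀ s, ((∃ a, M.src a = s ∧ π.Improving a) → π.Improving (π'.act s)) ∧
      ((¬ ∃ a, M.src a = s ∧ π.Improving a) → π'.act s = π.act s)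

/-- An iteration of simple policy iteration (a simplex pivot, with any pivot rule): switch to an
improving action in exactly one state. -/
def SimpleStep (π π' : M.Policy) : Prop :=
  ∃ s, π.Improving (π'.act s) ∧ ∀ t, t ≠ s → π'.act t = π.act t

end Policy

/-- The policy iteration methods. -/
inductive PIMethod
  | howard
  | simple

/-- One iteration of a policy iteration method. -/
def PIMethod.Step {M : SSP σ α} : PIMethod → M.Policy → M.Policy → Prop
  | .howard => Policy.HowardStep
  | .simple => Policy.SimpleStep

/-! ### The primal-dual algorithm -/

/-- The restricted subproblem at the dual solution `y`. -/
abbrev subproblem (M : SSP σ α) (y : σ → ℝ) : SSP σ (M.tight y ⊕ σ) := M.maxprob (M.tight y)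

/-- The configurations of the primal-dual algorithm: a dual solution `y` for which the subproblem is
still to be solved, a run of policy iteration on the subproblem at `y` with the current policy `π`,
and the final configuration. -/
inductive Config (M : SSP σ α)
  | outer (y : σ → ℝ) : Config M
  | inner (y : σ → ℝ) (π : (M.subproblem y).Policy) : Config M
  | done (y : σ → ℝ) (π : (M.subproblem y).Policy) : Config M

/-- The elementary steps of the primal-dual algorithm. Policy iteration may be started at any proper
policy of the subproblem. It ends when there is no improving action. If the cost of the resulting
solution of the subproblem is zero, then the algorithm terminates; otherwise the associated dual
solution `π.dual` of the subproblem is used as the direction of the update. -/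
inductive PDStep (M : SSP σ α) (method : PIMethod) : M.Config → M.Config → Prop
  | start (y : σ → ℝ) (π : (M.subproblem y).Policy) :
      π.Proper → PDStep M method (.outer y) (.inner y π)
  | improve (y : σ → ℝ) (π π' : (M.subproblem y).Policy) :
      method.Step π π' → PDStep M method (.inner y π) (.inner y π')
  | finish (y : σ → ℝ) (π : (M.subproblem y).Policy) :
      (¬ ∃ a, π.Improving a) → ∑ s, π.flux (Sum.inr s) = 0 →
      PDStep M method (.inner y π) (.done y π)
  | update (y : σ → ℝ) (π : (M.subproblem y).Policy) (ε : ℝ) :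
      (¬ ∃ a, π.Improving a) → ∑ s, π.flux (Sum.inr s) ≠ 0 →
      IsGreatest {δ : ℝ | 0 ≤ δ ∧ M.DualFeasible (y + δ • π.dual)} ε →
      PDStep M method (.inner y π) (.outer (y + ε • π.dual))

/-- The configurations reached by the algorithm when it is initialized with `y = 0`. -/
def Reached (M : SSP σ α) (method : PIMethod) (z : M.Config) : Prop :=
  Relation.ReflTransGen (M.PDStep method) (.outer 0) z

open Classical in
/-- The policy `π` solves the subproblem at `y`: its flux is optimal for the restricted primal, and
the associated dual solution is optimal for the dual of the restricted primal. -/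
def SolvesSubproblem [Fintype α] (M : SSP σ α) (y : σ → ℝ) (π : (M.subproblem y).Policy) : Prop :=
  (M.subproblem y).PrimalOptimal π.flux ∧ (M.subproblem y).DualOptimal π.dual

open Classical in
/-- The solution `x` of the original problem read off a policy of the subproblem: `x_a` is the flux
on the tight actions and zero on the others. -/
def output (M : SSP σ α) (y : σ → ℝ) (π : (M.subproblem y).Policy) : α → ℝ :=
  fun a => if h : a ∈ M.tight y then π.flux (Sum.inl ⟨a, h⟩) else 0

/-! ### Dijkstra's algorithm -/

/-- In the course of Dijkstra's algorithm (towards the target), `L s = some d` means that state `s`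
is permanently labelled with `d`, and `none` that it is not labelled yet; the target has label zero.
The arc `a` leaves an unlabelled state, enters the target or a labelled state, and proposes the
tentative label `v`. -/
def Tentative (M : SSP σ α) (L : σ → Option ℝ) (a : α) (v : ℝ) : Prop :=
  L (M.src a) = none ∧
    (((∀ s, M.P a s = 0) ∧ v = M.c a) ∨ ∃ s d, M.P a s = 1 ∧ L s = some d ∧ v = M.c a + d)

/-- A step of Dijkstra's algorithm: an unlabelled state with the smallest tentative label is
labelled permanently. -/
def DijkstraStep (M : SSP σ α) (L L' : σ → Option ℝ) : Prop :=
  ∃ a v, M.Tentative L a v ∧ (∀ b w, M.Tentative L b w → v ≤ w) ∧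
    L' = Function.update L (M.src a) (some v)

open Classical in
/-- The labels given by a dual solution `y`: a state is labelled, with `y s`, when it is connected
to the target by tight actions. -/
def labels (M : SSP σ α) (y : σ → ℝ) : σ → Option ℝ :=
  fun s => if (M.keep (M.tight y)).ReachesTarget s then some (y s) else none

end SSP

end

open Matrix

noncomputable section

namespace SSP

/-! ### Transient substochastic matrices -/

/-! Proper policies are those whose transition matrix Q is `Transient` (`Policy.proper_iff`). For
such Q the maximum principle orders the subsolutions and supersolutions of y = b + Qy, so I - Q is
invertible with nonnegative inverse.

Inside a subproblem the costs are nonnegative. A switch to improving actions then preserves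
properness (`Policy.Proper.switch`) and strictly lowers the sum of the dual values
(`Policy.Proper.sum_dual_lt`), so no policy recurs. Without improving actions, weak duality makes
flux and dual optimal.

Across dual updates the optimal value of the subproblem strictly drops (`maxprobValue_update_lt`):
the final policy survives the update, while a newly tight action cuts off its dual solution. This
value depends only on the tight set, so updates are finite in number. The step length exists because
a nonzero nonnegative direction cannot satisfy (J - P)w ≤ 0 when all states reach the target
(`dual_direction`). At value zero, complementary slackness gives optimality.

In a deterministic instance the update direction is the indicator of the unlabelled states. Hence
unlabelled states always share one dual value D, labels never change, and dual feasibility makes D a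
lower bound for all tentative labels. A newly connected state attains this bound, which is
Dijkstra's rule (`exists_dijkstraStep`). -/

lemma sum_mul_lt_of_row {σ : Type*} [Fintype σ] {q v : σ → ℝ} {m : ℝ} (hq : ∀ t, 0 ≤ q t)
    (hq1 : ∑ t, q t ≤ 1) (hm : 0 < m) (hv : ∀ t, v t ≤ m)
    (h : ∑ t, q t < 1 ∨ ∃ t, 0 < q t ∧ v t < m) : ∑ t, q t * v t < m := by
  have h1 : ∑ t, q t * v t ≤ ∑ t, q t * m :=
    Finset.sum_le_sum fun t _ => mul_le_mul_of_nonneg_left (hv t) (hq t)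
  rcases h with h | ⟨t, ht, hvt⟩
  · refine h1.trans_lt ?_
    rw [← Finset.sum_mul]
    nlinarith
  · have h2 : ∑ t, q t * v t < ∑ t, q t * m :=
      Finset.sum_lt_sum (fun t _ => mul_le_mul_of_nonneg_left (hv t) (hq t))
        ⟨t, Finset.mem_univ t, mul_lt_mul_of_pos_left hvt ht⟩
    refine h2.trans_le ?_
    rw [← Finset.sum_mul]
    nlinarith

/-- A substochastic matrix is transient if every state is connected to the target, expressed as an
induction principle. -/
structure Transient {σ : Type*} [Fintype σ] (Q : Matrix σ σ ℝ) : Prop where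
  nonneg : ∀ s t, 0 ≤ Q s t
  row_le_one : ∀ s, ∑ t, Q s t ≤ 1
  induct : ∀ p : σ → Prop, (∀ s, ∑ t, Q s t < 1 → p s) → (∀ s t, 0 < Q s t → p t → p s) →
    ∀ s, p s

namespace Transient

variable {σ : Type*} [Fintype σ] {Q : Matrix σ σ ℝ}

/-- The maximum principle. -/
lemma nonpos_of_le (hQ : Transient Q) {v : σ → ℝ} (hv : ∀ s, v s ≤ ∑ t, Q s t * v t) (s : σ) :
    v s ≤ 0 := by
  by_contra! hs
  have : Nonempty σ := ⟨s⟩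
  obtain ⟨u, hu⟩ := Finite.exists_max v
  have hm : 0 < v u := hs.trans_le (hu s)
  -- Being strictly below the positive maximum holds where mass is lost and passes to predecessors,
  -- so it would hold at the maximizer `u` itself.
  exact lt_irrefl _ (hQ.induct (fun t => v t < v u)
    (fun t ht => (hv t).trans_lt
      (sum_mul_lt_of_row (hQ.nonneg t) (hQ.row_le_one t) hm hu (Or.inl ht)))
    (fun t r htr hr => (hv t).trans_lt
      (sum_mul_lt_of_row (hQ.nonneg t) (hQ.row_le_one t) hm hu (Or.inr ⟨r, htr, hr⟩))) u)

/-- The term `b` cancels in `v - w`, to which the maximum principle applies: subsolutions lie below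
supersolutions. -/
lemma le_of_le (hQ : Transient Q) {b v w : σ → ℝ} (hv : ∀ s, v s ≤ b s + ∑ t, Q s t * v t)
    (hw : ∀ s, b s + ∑ t, Q s t * w t ≤ w s) (s : σ) : v s ≤ w s := by
  have := hQ.nonpos_of_le (v := fun s => v s - w s) (fun s => by
    simp only [mul_sub, Finset.sum_sub_distrib]
    linarith [hv s, hw s]) s
  linarith

variable [DecidableEq σ]

lemma one_sub_mulVec (v : σ → ℝ) (s : σ) : ((1 - Q) *ᵥ v) s = v s - ∑ t, Q s t * v t := by
  rw [sub_mulVec, one_mulVec]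
  rfl

lemma isUnit_det (hQ : Transient Q) : IsUnit (1 - Q).det := by
  rw [← Matrix.isUnit_iff_isUnit_det, ← Matrix.mulVec_injective_iff_isUnit]
  intro v w hvw
  have h : ∀ s, v s - ∑ t, Q s t * v t = w s - ∑ t, Q s t * w t := fun s => by
    rw [← one_sub_mulVec, ← one_sub_mulVec]
    exact congrFun hvw s
  funext s
  exact le_antisymm
    (hQ.le_of_le (b := fun s => v s - ∑ t, Q s t * v t) (fun s => by linarith)
      (fun s => by linarith [h s]) s)
    (hQ.le_of_le (b := fun s => v s - ∑ t, Q s t * v t) (fun s => by linarith [h s])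
      (fun s => by linarith) s)

lemma inv_mulVec_eq (hQ : Transient Q) (b : σ → ℝ) (s : σ) :
    ((1 - Q)⁻¹ *ᵥ b) s = b s + ∑ t, Q s t * ((1 - Q)⁻¹ *ᵥ b) t := by
  have h : (1 - Q) *ᵥ ((1 - Q)⁻¹ *ᵥ b) = b := by
    rw [mulVec_mulVec, mul_nonsing_inv _ hQ.isUnit_det, one_mulVec]
  have := congrFun h s
  rw [one_sub_mulVec] at this
  linarith

lemma inv_mulVec_nonneg (hQ : Transient Q) {b : σ → ℝ} (hb : ∀ s, 0 ≤ b s) (s : σ) :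
    0 ≤ ((1 - Q)⁻¹ *ᵥ b) s :=
  hQ.le_of_le (b := b) (v := 0) (by simpa using hb) (fun s => (hQ.inv_mulVec_eq b s).ge) s

lemma inv_nonneg (hQ : Transient Q) (s t : σ) : 0 ≤ (1 - Q)⁻¹ s t := by
  have := hQ.inv_mulVec_nonneg (b := Pi.single t 1)
    (fun r => by by_cases h : r = t <;> simp [h]) s
  simpa using this

lemma inv_transpose_mulVec_eq (hQ : Transient Q) (s : σ) :
    ((1 - Q)ᵀ⁻¹ *ᵥ 1) s = 1 + ∑ t, Q t s * ((1 - Q)ᵀ⁻¹ *ᵥ 1) t := by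
  have h : (1 - Q)ᵀ *ᵥ ((1 - Q)ᵀ⁻¹ *ᵥ (1 : σ → ℝ)) = 1 := by
    rw [mulVec_mulVec, mul_nonsing_inv _ (by rw [det_transpose]; exact hQ.isUnit_det), one_mulVec]
  have := congrFun h s
  rw [transpose_sub, transpose_one, one_sub_mulVec] at this
  simp only [transpose_apply, Pi.one_apply] at this
  rw [transpose_sub, transpose_one]
  linarith

lemma one_le_inv_transpose_mulVec (hQ : Transient Q) (s : σ) : 1 ≤ ((1 - Q)ᵀ⁻¹ *ᵥ 1) s := by
  have h : ∀ t, 0 ≤ ((1 - Q)ᵀ⁻¹ *ᵥ (1 : σ → ℝ)) t := fun t => by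
    rw [← transpose_nonsing_inv]
    exact Finset.sum_nonneg fun r _ => by simpa using hQ.inv_nonneg r t
  rw [hQ.inv_transpose_mulVec_eq s]
  linarith [Finset.sum_nonneg fun t (_ : t ∈ Finset.univ) => mul_nonneg (hQ.nonneg t s) (h t)]

lemma pow_nonneg (hQ : ∀ s t, 0 ≤ Q s t) (k : ℕ) (s t : σ) : 0 ≤ (Q ^ k) s t := by
  induction k generalizing s with
  | zero => by_cases h : s = t <;> simp [h]
  | succ k ih =>
    rw [pow_succ', mul_apply]
    exact Finset.sum_nonneg fun r _ => mul_nonneg (hQ s r) (ih r)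

/-- The partial sums of the Neumann series obey S ↦ 1 + QS, a monotone map that fixes the bound.
Summability of the powers follows without spectral theory. -/
lemma sum_range_pow_mulVec_le (hQ : Transient Q) (N : ℕ) (s : σ) :
    (∑ k ∈ Finset.range N, (Q ^ k) *ᵥ (1 : σ → ℝ)) s ≤ ((1 - Q)⁻¹ *ᵥ 1) s := by
  induction N generalizing s with
  | zero => simpa using hQ.inv_mulVec_nonneg (b := 1) (by simp) s
  | succ N ih =>
    have h : ∑ k ∈ Finset.range (N + 1), (Q ^ k) *ᵥ (1 : σ → ℝ) =
        1 + Q *ᵥ ∑ k ∈ Finset.range N, (Q ^ k) *ᵥ (1 : σ → ℝ) := by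
      rw [Finset.sum_range_succ', Matrix.mulVec_sum, add_comm]
      simp [pow_succ', mulVec_mulVec]
    rw [h, hQ.inv_mulVec_eq]
    exact add_le_add le_rfl (Finset.sum_le_sum fun t _ =>
      mul_le_mul_of_nonneg_left (ih t) (hQ.nonneg s t))

lemma summable_pow (hQ : Transient Q) (s t : σ) : Summable fun k : ℕ => (Q ^ k) s t := by
  refine summable_of_sum_range_le (c := ((1 - Q)⁻¹ *ᵥ 1) s)
    (fun k => pow_nonneg hQ.nonneg k s t) fun N => ?_
  refine le_trans ?_ (hQ.sum_range_pow_mulVec_le N s)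
  rw [Finset.sum_apply]
  refine Finset.sum_le_sum fun k _ => ?_
  simp only [mulVec, dotProduct, Pi.one_apply, mul_one]
  exact Finset.single_le_sum (f := fun t => (Q ^ k) s t)
    (fun r _ => pow_nonneg hQ.nonneg k s r) (Finset.mem_univ t)

-- If `p` failed somewhere, the states violating it would lose no mass and lead only to each other.
-- Every power of `Q` would keep mass at least 1 there, although the powers tend to zero.
open Classical in
lemma of_summable (h0 : ∀ s t, 0 ≤ Q s t) (h1 : ∀ s, ∑ t, Q s t ≤ 1)
    (h : ∀ s t, Summable fun k : ℕ => (Q ^ k) s t) : Transient Q := by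
  refine ⟨h0, h1, fun p hp1 hp2 s => ?_⟩
  by_contra hs
  have key : ∀ (k : ℕ) (s : σ), ¬ p s → 1 ≤ ∑ t, (Q ^ k) s t * (if p t then 0 else 1) := by
    intro k
    induction k with
    | zero =>
      intro s hs
      rw [Finset.sum_eq_single s (fun t _ hts => by simp [Matrix.one_apply_ne hts.symm])
        (by simp)]
      simp [hs]
    | succ k ih =>
      intro s hs
      have e : ∑ t, (Q ^ (k + 1)) s t * (if p t then (0 : ℝ) else 1) =
          ∑ r, Q s r * ∑ t, (Q ^ k) r t * (if p t then 0 else 1) := by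
        simp only [pow_succ', mul_apply, Finset.sum_mul, Finset.mul_sum]
        rw [Finset.sum_comm]
        simp only [mul_assoc]
      rw [e]
      refine (not_lt.1 fun hlt => hs (hp1 s hlt)).trans (Finset.sum_le_sum fun r _ => ?_)
      rcases (h0 s r).eq_or_lt with hr | hr
      · simp [← hr]
      · exact le_mul_of_one_le_right hr.le (ih r fun hpr => hs (hp2 s r hr hpr))
  have hsum : Summable fun k : ℕ => ∑ t, (Q ^ k) s t * (if p t then (0 : ℝ) else 1) :=
    summable_sum fun t _ => (h s t).mul_right _
  have := ge_of_tendsto' hsum.tendsto_atTop_zero fun k => key k s hs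
  linarith

end Transient

/-! ### Reachability -/

section

variable {σ α : Type*} [Fintype σ] {M : SSP σ α}

lemma reachesTarget_of_lt {a : α} (h : ∑ s, M.P a s < 1) : M.ReachesTarget (M.src a) :=
  .head (.stateAction a) (.head (.actionTarget a h) .refl)

lemma reachesTarget_of_pos {a : α} {t : σ} (h : 0 < M.P a t) (ht : M.ReachesTarget t) :
    M.ReachesTarget (M.src a) :=
  .head (.stateAction a) (.head (.actionState a t h) ht)

lemma ReachesTarget.induct {p : σ → Prop} (h1 : ∀ a, ∑ s, M.P a s < 1 → p (M.src a))
    (h2 : ∀ a t, 0 < M.P a t → p t → p (M.src a)) {s : σ} (hs : M.ReachesTarget s) : p s := by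
  -- An action vertex inherits `p` of its source, and the condition is vacuous at the target, so `q`
  -- can be carried backwards along the path.
  let q : Option σ ⊕ Option α → Prop :=
    Sum.elim (fun o => ∀ t, o = some t → p t) (fun o => ∀ a, o = some a → p (M.src a))
  have hq : q (Sum.inl (some s)) := by
    refine Relation.ReflTransGen.head_induction_on (motive := fun v _ => q v) hs ?_ ?_
    · intro t ht
      cases ht
    · intro v w hvw _ hw
      cases hvw with
      | stateAction a => intro t ht; cases ht; exact hw a rfl
      | actionState a t hat => intro b hb; cases hb; exact h2 a t hat (hw t rfl)
      | actionTarget a ha => intro b hb; cases hb; exact h1 a ha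
      | targetOut => intro t ht; cases ht
      | targetIn => intro t ht; cases ht
  exact hq s rfl

/-- When every state reaches the target, a vector `v` with `(J - P) v ≤ 0` is nonpositive. -/
lemma nonpos_of_forall_le (hreach : ∀ s, M.ReachesTarget s) {v : σ → ℝ}
    (hv : ∀ a, v (M.src a) ≤ ∑ t, M.P a t * v t) (s : σ) : v s ≤ 0 := by
  by_contra! hs
  have : Nonempty σ := ⟨s⟩
  obtain ⟨u, hu⟩ := Finite.exists_max v
  have hm : 0 < v u := hs.trans_le (hu s)
  exact lt_irrefl _ ((hreach u).induct (p := fun t => v t < v u)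
    (fun a ha => (hv a).trans_lt
      (sum_mul_lt_of_row (M.P_nonneg a) (M.P_row_le_one a) hm hu (Or.inl ha)))
    (fun a r har hr => (hv a).trans_lt
      (sum_mul_lt_of_row (M.P_nonneg a) (M.P_row_le_one a) hm hu (Or.inr ⟨r, har, hr⟩))))

namespace Policy

lemma lift_act (π : M.Policy) (w : σ → ℝ) (s : σ) : π.lift w (π.act s) = w s := by
  simp [lift, π.src_act]

lemma act_injective (π : M.Policy) : Function.Injective π.act :=
  Function.LeftInverse.injective π.src_act

lemma finite_policy [Finite α] : Finite M.Policy :=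
  Finite.of_injective (fun π : M.Policy => π.act) fun π π' h => by
    cases π; cases π'; simpa using h

lemma sum_mul_lift [Fintype α] (π : M.Policy) (w : σ → ℝ) (g : α → ℝ) :
    ∑ a, g a * π.lift w a = ∑ s, g (π.act s) * w s := by
  classical
  rw [← Finset.sum_subset (Finset.subset_univ (Finset.univ.image π.act)),
    Finset.sum_image π.act_injective.injOn]
  · simp only [lift_act]
  · intro a _ ha
    have : π.act (M.src a) ≠ a := fun h => ha (Finset.mem_image.2 ⟨_, Finset.mem_univ _, h⟩)
    simp [lift, this]

end Policy

end

/-! ### Proper policies -/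

section

variable {σ α : Type*} [Fintype σ] [DecidableEq σ] {M : SSP σ α}

lemma J_sub_P_mulVec (y : σ → ℝ) (a : α) :
    ((M.J - M.P) *ᵥ y) a = y (M.src a) - ∑ s, M.P a s * y s := by
  rw [sub_mulVec]
  simp [mulVec, dotProduct, J]

lemma dualFeasible_iff {y : σ → ℝ} :
    M.DualFeasible y ↔ ∀ a, y (M.src a) ≤ M.c a + ∑ s, M.P a s * y s := by
  simp only [DualFeasible, Pi.le_def, J_sub_P_mulVec, sub_le_iff_le_add]

lemma mem_tight_iff {y : σ → ℝ} {a : α} :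
    a ∈ M.tight y ↔ y (M.src a) = M.c a + ∑ s, M.P a s * y s := by
  simp only [tight, Set.mem_ofPred_eq, J_sub_P_mulVec, sub_eq_iff_eq_add]

lemma weak_duality [Fintype α] {x : α → ℝ} {y : σ → ℝ} (hx : M.PrimalFeasible x)
    (hy : M.DualFeasible y) : ∑ s, y s ≤ M.c ⬝ᵥ x := by
  calc ∑ s, y s = y ⬝ᵥ ((M.J - M.P)ᵀ *ᵥ x) := by rw [hx.1]; simp [dotProduct]
    _ = ((M.J - M.P) *ᵥ y) ⬝ᵥ x := by rw [dotProduct_mulVec, vecMul_transpose]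
    _ ≤ M.c ⬝ᵥ x := Finset.sum_le_sum fun a _ => mul_le_mul_of_nonneg_right (hy a) (hx.2 a)

lemma optimal_of_eq [Fintype α] {x : α → ℝ} {y : σ → ℝ} (hx : M.PrimalFeasible x)
    (hy : M.DualFeasible y) (h : M.c ⬝ᵥ x = ∑ s, y s) : M.PrimalOptimal x ∧ M.DualOptimal y :=
  ⟨⟨hx, fun _ hx' => h.le.trans (weak_duality hx' hy)⟩,
    ⟨hy, fun _ hy' => (weak_duality hx hy').trans h.le⟩⟩

namespace Policy

lemma proper_iff (π : M.Policy) : π.Proper ↔ Transient π.transition := by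
  have e : ∀ (s t : σ) (k : ℕ), π.stateDist (Pi.single s 1) k t = (π.transition ^ k) s t := by
    intro s t k
    simp [stateDist, ← transpose_pow]
  constructor
  · intro h
    refine Transient.of_summable (fun s t => M.P_nonneg _ _) (fun s => M.P_row_le_one _)
      fun s t => ?_
    simpa only [lift_act, e] using Pi.summable.1 (h s) (π.act t)
  · intro h s
    rw [Pi.summable]
    intro a
    by_cases ha : π.act (M.src a) = a
    · simpa only [lift, if_pos ha, e] using h.summable_pow s (M.src a)
    · simpa only [lift, if_neg ha] using summable_zero

variable {π : M.Policy}

lemma Proper.dual_eq (h : π.Proper) (s : σ) :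
    π.dual s = M.c (π.act s) + ∑ t, M.P (π.act s) t * π.dual t :=
  (π.proper_iff.1 h).inv_mulVec_eq π.actCost s

lemma Proper.dual_nonneg (h : π.Proper) (hc : ∀ a, 0 ≤ M.c a) (s : σ) : 0 ≤ π.dual s :=
  (π.proper_iff.1 h).inv_mulVec_nonneg (fun _ => hc _) s

/-- The dual constraints of the chosen actions alone make `v` a subsolution of the policy's
equation. -/
lemma Proper.le_dual (h : π.Proper) {v : σ → ℝ} (hv : M.DualFeasible v) (s : σ) :
    v s ≤ π.dual s := by
  refine (π.proper_iff.1 h).le_of_le (b := π.actCost) (fun s => ?_) (fun s => (h.dual_eq s).ge) s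
  have := dualFeasible_iff.1 hv (π.act s)
  rwa [π.src_act] at this

lemma Proper.flux_nonneg (h : π.Proper) (a : α) : 0 ≤ π.flux a := by
  unfold flux lift
  split_ifs
  · exact zero_le_one.trans ((π.proper_iff.1 h).one_le_inv_transpose_mulVec _)
  · exact le_rfl

lemma Proper.primalFeasible_flux [Fintype α] (h : π.Proper) : M.PrimalFeasible π.flux := by
  refine ⟨funext fun s => ?_, fun a => h.flux_nonneg a⟩
  have e := π.sum_mul_lift ((1 - π.transition)ᵀ⁻¹ *ᵥ 1) (fun a => (M.J - M.P) a s)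
  have := (π.proper_iff.1 h).inv_transpose_mulVec_eq s
  change ∑ a, (M.J - M.P) a s * π.flux a = 1
  rw [flux, e]
  simp only [Matrix.sub_apply, J, of_apply, π.src_act, sub_mul, Finset.sum_sub_distrib, ite_mul, one_mul,
    zero_mul, Finset.sum_ite_eq', Finset.mem_univ, if_true]
  simp only [transition, of_apply] at this ⊢
  linarith

lemma Proper.dotProduct_flux [Fintype α] (h : π.Proper) : M.c ⬝ᵥ π.flux = ∑ s, π.dual s := by
  have e : ∀ s, M.c (π.act s) = ((1 - π.transition) *ᵥ π.dual) s := fun s => by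
    rw [Transient.one_sub_mulVec, h.dual_eq s]
    simp [transition]
  have h1 : M.c ⬝ᵥ π.flux = ((1 - π.transition) *ᵥ π.dual) ⬝ᵥ ((1 - π.transition)ᵀ⁻¹ *ᵥ 1) :=
    (π.sum_mul_lift _ M.c).trans (Finset.sum_congr rfl fun s _ => by rw [e])
  rw [h1, ← vecMul_transpose, ← dotProduct_mulVec, mulVec_mulVec,
    mul_nonsing_inv _ (by rw [det_transpose]; exact (π.proper_iff.1 h).isUnit_det), one_mulVec]
  simp [dotProduct]

lemma improving_iff {a : α} :
    π.Improving a ↔ M.c a + ∑ t, M.P a t * π.dual t < π.dual (M.src a) := by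
  simp only [Improving, reducedCost, Pi.sub_apply, J_sub_P_mulVec]
  constructor <;> intro h <;> linarith

lemma dualFeasible_dual (h : ¬ ∃ a, π.Improving a) : M.DualFeasible π.dual := by
  simp only [improving_iff, not_exists, not_lt] at h
  exact dualFeasible_iff.2 h

lemma Proper.optimal [Fintype α] (hp : π.Proper) (h : ¬ ∃ a, π.Improving a) :
    M.PrimalOptimal π.flux ∧ M.DualOptimal π.dual :=
  optimal_of_eq hp.primalFeasible_flux (dualFeasible_dual h) hp.dotProduct_flux

/-! ### Policy iteration -/

/-- The policy `π'` arises from `π` by switching to improving actions, in at least one state. -/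
def Switch (π π' : M.Policy) : Prop :=
  (∃ s, π.Improving (π'.act s)) ∧ ∀ s, π.Improving (π'.act s) ∨ π'.act s = π.act s

lemma Switch.of_step {method : PIMethod} {π' : M.Policy} (h : method.Step π π') :
    π.Switch π' := by
  cases method with
  | howard =>
    obtain ⟨⟨a, ha⟩, h⟩ := h
    refine ⟨⟨M.src a, (h _).1 ⟨a, rfl, ha⟩⟩, fun s => ?_⟩
    by_cases hs : ∃ a, M.src a = s ∧ π.Improving a
    · exact Or.inl ((h s).1 hs)
    · exact Or.inr ((h s).2 hs)
  | simple =>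
    obtain ⟨s, hs, h⟩ := h
    refine ⟨⟨s, hs⟩, fun t => ?_⟩
    by_cases hts : t = s
    · exact Or.inl (hts ▸ hs)
    · exact Or.inr (h t hts)

lemma exists_step (method : PIMethod) (h : ∃ a, π.Improving a) :
    ∃ π', method.Step π π' := by
  classical
  cases method with
  | howard =>
    refine ⟨⟨fun s => if hs : ∃ a, M.src a = s ∧ π.Improving a then hs.choose else π.act s,
      fun s => ?_⟩, h, fun s => ⟨fun hs => ?_, fun hs => ?_⟩⟩
    · split_ifs with hs
      · exact hs.choose_spec.1
      · exact π.src_act s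
    · simp only [dif_pos hs]
      exact hs.choose_spec.2
    · simp only [dif_neg hs]
  | simple =>
    obtain ⟨a, ha⟩ := h
    refine ⟨⟨Function.update π.act (M.src a) a, fun s => ?_⟩, M.src a, ?_, fun t ht => ?_⟩
    · rcases eq_or_ne s (M.src a) with rfl | hs
      · simp
      · simp [hs, π.src_act]
    · simpa using ha
    · simp [ht]

lemma Proper.act_le (hp : π.Proper) {π' : M.Policy} (h : π.Switch π') (s : σ) :
    M.c (π'.act s) + ∑ t, M.P (π'.act s) t * π.dual t ≤ π.dual s := by
  rcases h.2 s with hs | hs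
  · simpa [π'.src_act] using (improving_iff.1 hs).le
  · rw [hs]
    exact (hp.dual_eq s).ge

/-- Suppose `π'` had a trapped set, and take the states in it that minimize `π.dual`. With
nonnegative costs no improving action can be used there, so `π'` agrees with `π` on the minimizers.
These are then closed under `π` itself, against its properness. -/
lemma Proper.switch (hc : ∀ a, 0 ≤ M.c a) (hp : π.Proper) {π' : M.Policy} (h : π.Switch π') :
    π'.Proper := by
  classical
  rw [proper_iff]
  refine ⟨fun s t => M.P_nonneg _ _, fun s => M.P_row_le_one _, fun p hp1 hp2 s0 => ?_⟩
  by_contra hs0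
  simp only [transition, of_apply] at hp1 hp2
  obtain ⟨u, hu, hmin⟩ := (Finset.univ.filter fun s => ¬ p s).exists_min_image π.dual
    ⟨s0, by simpa using hs0⟩
  simp only [Finset.mem_filter, Finset.mem_univ, true_and] at hu hmin
  have hge : ∀ s, ¬ p s → ∀ t, M.P (π'.act s) t * π.dual u ≤ M.P (π'.act s) t * π.dual t := by
    intro s hs t
    rcases (M.P_nonneg (π'.act s) t).eq_or_lt with ht | ht
    · simp [← ht]
    · exact mul_le_mul_of_nonneg_left (hmin t fun hpt => hs (hp2 s t ht hpt)) ht.le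
  have hrow : ∀ s, ¬ p s → ∑ t, M.P (π'.act s) t * π.dual u = π.dual u := by
    intro s hs
    rw [← Finset.sum_mul, (M.P_row_le_one _).antisymm (not_lt.1 fun h => hs (hp1 s h)), one_mul]
  have hkeep : ∀ s, ¬ p s → π.dual s = π.dual u → π'.act s = π.act s := by
    intro s hs hsu
    refine (h.2 s).resolve_left fun hi => ?_
    have h1 := improving_iff.1 hi
    rw [π'.src_act] at h1
    have h2 := Finset.sum_le_sum fun t (_ : t ∈ Finset.univ) => hge s hs t
    rw [hrow s hs] at h2
    linarith [hc (π'.act s)]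
  -- A minimizer moving with positive probability to a trapped non-minimizer would have continuation
  -- value above the minimum, contradicting `act_le`.
  refine (π.proper_iff.1 hp).induct (fun s => ¬ (¬ p s ∧ π.dual s = π.dual u)) ?_ ?_ u ⟨hu, rfl⟩
  · rintro s hs ⟨hps, hsu⟩
    refine hps (hp1 s ?_)
    rwa [hkeep s hps hsu]
  · rintro s t hst ht ⟨hps, hsu⟩
    have hst' : 0 < M.P (π'.act s) t := by rwa [hkeep s hps hsu]
    have hpt : ¬ p t := fun hpt => hps (hp2 s t hst' hpt)
    have hut : π.dual u < π.dual t := (hmin t hpt).lt_of_ne fun e => ht ⟨hpt, e.symm⟩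
    have h2 := Finset.sum_lt_sum (fun t (_ : t ∈ Finset.univ) => hge s hps t)
      ⟨t, Finset.mem_univ t, mul_lt_mul_of_pos_left hut hst'⟩
    rw [hrow s hps] at h2
    linarith [hc (π'.act s), hp.act_le h s]

/-- The old dual is a supersolution for the new policy, strictly so at a switched state. -/
lemma Proper.sum_dual_lt (hc : ∀ a, 0 ≤ M.c a) (hp : π.Proper) {π' : M.Policy}
    (h : π.Switch π') : ∑ s, π'.dual s < ∑ s, π.dual s := by
  have hp' := hp.switch hc h
  have hle : ∀ s, π'.dual s ≤ π.dual s := (π'.proper_iff.1 hp').le_of_le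
    (fun s => (hp'.dual_eq s).le) (fun s => hp.act_le h s)
  obtain ⟨s, hs⟩ := h.1
  refine Finset.sum_lt_sum (fun s _ => hle s) ⟨s, Finset.mem_univ s, ?_⟩
  have h1 := improving_iff.1 hs
  rw [π'.src_act] at h1
  have h2 : ∑ t, M.P (π'.act s) t * π'.dual t ≤ ∑ t, M.P (π'.act s) t * π.dual t :=
    Finset.sum_le_sum fun t _ => mul_le_mul_of_nonneg_left (hle t) (M.P_nonneg _ _)
  rw [hp'.dual_eq s]
  linarith

end Policy

end

/-! ### Restricted action sets and deterministic rows -/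

section

variable {σ α : Type*} [Fintype σ] {M : SSP σ α}

lemma maxprob_c_nonneg (A : Set α) (a : A ⊕ σ) : 0 ≤ (M.maxprob A).c a := by
  rcases a with a | s
  · exact le_rfl
  · exact zero_le_one

lemma keep_reaches_of_lt {A : Set α} {a : α} (ha : a ∈ A) (h : ∑ s, M.P a s < 1) :
    (M.keep A).ReachesTarget (M.src a) :=
  reachesTarget_of_lt (M := M.keep A) (a := ⟨a, ha⟩) h

lemma keep_reaches_of_pos {A : Set α} {a : α} (ha : a ∈ A) {t : σ} (h : 0 < M.P a t)
    (ht : (M.keep A).ReachesTarget t) : (M.keep A).ReachesTarget (M.src a) :=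
  reachesTarget_of_pos (M := M.keep A) (a := ⟨a, ha⟩) h ht

lemma keep_reaches_induct {A : Set α} {p : σ → Prop}
    (h1 : ∀ a ∈ A, ∑ s, M.P a s < 1 → p (M.src a))
    (h2 : ∀ a ∈ A, ∀ t, 0 < M.P a t → p t → p (M.src a)) {s : σ}
    (hs : (M.keep A).ReachesTarget s) : p s :=
  hs.induct (M := M.keep A) (fun a ha => h1 _ a.2 ha) (fun a t ht => h2 _ a.2 t ht)

lemma sum_mul_of_eq_one {a : α} {t : σ} (ht : M.P a t = 1) (v : σ → ℝ) :
    ∑ s, M.P a s * v s = v t := by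
  rw [Finset.sum_eq_single t, ht, one_mul]
  · intro s _ hst
    refine mul_eq_zero_of_left (le_antisymm ?_ (M.P_nonneg a s)) _
    have h1 := Finset.add_le_sum (f := M.P a) (fun r _ => M.P_nonneg a r)
      (Finset.mem_univ s) (Finset.mem_univ t) hst
    linarith [M.P_row_le_one a]
  · simp

lemma Deterministic.row_eq_zero (hM : M.Deterministic) {a : α} (h : ∑ s, M.P a s < 1) (s : σ) :
    M.P a s = 0 := by
  refine (hM a s).resolve_right fun h1 => ?_
  have := Finset.single_le_sum (f := M.P a) (fun r _ => M.P_nonneg a r) (Finset.mem_univ s)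
  linarith

lemma Deterministic.sum_mul_of_pos (hM : M.Deterministic) {a : α} {t : σ} (ht : 0 < M.P a t)
    (v : σ → ℝ) : ∑ s, M.P a s * v s = v t :=
  sum_mul_of_eq_one ((hM a t).resolve_left ht.ne') v

variable [DecidableEq σ]

/-! ### The subproblems -/

lemma maxprob_dualFeasible_iff {A : Set α} {v : σ → ℝ} :
    (M.maxprob A).DualFeasible v ↔
      (∀ a ∈ A, v (M.src a) ≤ ∑ s, M.P a s * v s) ∧ ∀ s, v s ≤ 1 := by
  rw [dualFeasible_iff]
  simp [maxprob]

/-- The artificial policy of the subproblem. -/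
def artificial (M : SSP σ α) (A : Set α) : (M.maxprob A).Policy := ⟨Sum.inr, fun _ => rfl⟩

lemma artificial_proper (A : Set α) : (M.artificial A).Proper := by
  rw [Policy.proper_iff]
  have h : ∀ s t, (M.artificial A).transition s t = 0 := fun s t => rfl
  exact ⟨fun s t => (h s t).ge, fun s => by simp [h], fun p hp _ s => hp s (by simp [h])⟩

/-- The optimal value of the subproblem with the action set `A`. -/
def maxprobValue (M : SSP σ α) (A : Set α) : ℝ :=
  sSup {r | ∃ v, (M.maxprob A).DualFeasible v ∧ r = ∑ s, v s}

lemma maxprobValue_eq {A : Set α} {v : σ → ℝ} (hv : (M.maxprob A).DualOptimal v) :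
    M.maxprobValue A = ∑ s, v s :=
  IsGreatest.csSup_eq ⟨⟨v, hv.1, rfl⟩, by rintro _ ⟨w, hw, rfl⟩; exact hv.2 w hw⟩

lemma maxprobValue_le {A : Set α} {r : ℝ}
    (h : ∀ v, (M.maxprob A).DualFeasible v → ∑ s, v s ≤ r) : M.maxprobValue A ≤ r :=
  csSup_le ⟨_, 0, maxprob_dualFeasible_iff.2 (by simp), rfl⟩
    (by rintro _ ⟨v, hv, rfl⟩; exact h v hv)

lemma sum_flux_inr [Finite α] {A : Set α} {π : (M.maxprob A).Policy} (hp : π.Proper) :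
    ∑ s, π.flux (Sum.inr s) = ∑ s, π.dual s := by
  have := Fintype.ofFinite A
  rw [← hp.dotProduct_flux]
  simp [dotProduct, maxprob]

lemma dual_eq_zero [Finite α] {A : Set α} {π : (M.maxprob A).Policy} (hp : π.Proper)
    (h : ∑ s, π.flux (Sum.inr s) = 0) (s : σ) : π.dual s = 0 := by
  rw [sum_flux_inr hp, Finset.sum_eq_zero_iff_of_nonneg
    fun s _ => hp.dual_nonneg (maxprob_c_nonneg A) s] at h
  exact h s (Finset.mem_univ s)

/-! ### Dual updates -/

/-- `ε` is a maximal step length from `y` in direction `w`. -/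
def MaxStep (M : SSP σ α) (y w : σ → ℝ) (ε : ℝ) : Prop :=
  IsGreatest {δ : ℝ | 0 ≤ δ ∧ M.DualFeasible (y + δ • w)} ε

lemma dualFeasible_add_iff {y w : σ → ℝ} {δ : ℝ} : M.DualFeasible (y + δ • w) ↔
    ∀ a, ((M.J - M.P) *ᵥ y) a + δ * ((M.J - M.P) *ᵥ w) a ≤ M.c a := by
  simp [DualFeasible, Pi.le_def, mulVec_add, mulVec_smul]

lemma exists_maxStep {y w : σ → ℝ} (hy : M.DualFeasible y)
    (hw : ∃ a, 0 < ((M.J - M.P) *ᵥ w) a) : ∃ ε, M.MaxStep y w ε := by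
  obtain ⟨a, ha⟩ := hw
  have hne : {δ : ℝ | 0 ≤ δ ∧ M.DualFeasible (y + δ • w)}.Nonempty :=
    ⟨0, le_rfl, by simpa using hy⟩
  have hbdd : BddAbove {δ : ℝ | 0 ≤ δ ∧ M.DualFeasible (y + δ • w)} := by
    refine ⟨(M.c a - ((M.J - M.P) *ᵥ y) a) / ((M.J - M.P) *ᵥ w) a, fun δ hδ => ?_⟩
    rw [le_div_iff₀ ha]
    linarith [dualFeasible_add_iff.1 hδ.2 a]
  have hcl : IsClosed {δ : ℝ | 0 ≤ δ ∧ M.DualFeasible (y + δ • w)} := by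
    simp only [dualFeasible_add_iff, Set.ofPred_and, Set.ofPred_forall]
    exact isClosed_Ici.inter (isClosed_iInter fun a =>
      isClosed_le (by fun_prop) continuous_const)
  exact ⟨_, hcl.csSup_mem hne hbdd, fun δ hδ => le_csSup hbdd hδ⟩

/-- Otherwise each of the finitely many constraints, slack or with nonpositive slope, would survive
a slightly longer step. -/
lemma MaxStep.exists_tight [Finite α] {y w : σ → ℝ} {ε : ℝ} (h : M.MaxStep y w ε) :
    ∃ a ∈ M.tight (y + ε • w), 0 < ((M.J - M.P) *ᵥ w) a := by
  by_contra! hne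
  have hev : ∀ a, ∀ᶠ η in nhdsWithin (0 : ℝ) (Set.Ioi 0),
      ((M.J - M.P) *ᵥ (y + ε • w)) a + η * ((M.J - M.P) *ᵥ w) a ≤ M.c a := by
    intro a
    rcases (h.1.2 a).eq_or_lt with ha | ha
    · filter_upwards [self_mem_nhdsWithin] with η hη
      nlinarith [hne a ha, Set.mem_Ioi.1 hη]
    · refine Filter.Eventually.filter_mono nhdsWithin_le_nhds ?_
      have hc : Continuous fun η : ℝ =>
          ((M.J - M.P) *ᵥ (y + ε • w)) a + η * ((M.J - M.P) *ᵥ w) a := by fun_prop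
      have := hc.continuousAt.eventually_lt (x₀ := 0) (continuousAt_const (y := M.c a))
        (by simpa using ha)
      exact this.mono fun η hη => hη.le
  obtain ⟨η, hη, hpos⟩ := ((Filter.eventually_all.2 hev).and self_mem_nhdsWithin).exists
  have hpos' : 0 < η := hpos
  have := h.2 (show ε + η ∈ _ from ⟨add_nonneg h.1.1 hpos'.le, by
    rw [add_smul, ← add_assoc]
    exact dualFeasible_add_iff.2 hη⟩)
  linarith

lemma mem_tight_add {y w : σ → ℝ} {a : α} (ha : a ∈ M.tight y)
    (hw : ((M.J - M.P) *ᵥ w) a = 0) (ε : ℝ) : a ∈ M.tight (y + ε • w) := by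
  have ha' : ((M.J - M.P) *ᵥ y) a = M.c a := ha
  change ((M.J - M.P) *ᵥ (y + ε • w)) a = M.c a
  simp [mulVec_add, mulVec_smul, ha', hw]

/-- If (J - P)w ≤ 0, reachability forces w ≤ 0. But the subproblem dual is nonnegative with nonzero
sum. This bounds the step length. -/
lemma dual_direction (hreach : ∀ s, M.ReachesTarget s) [Finite α] {A : Set α}
    {π : (M.maxprob A).Policy} (hp : π.Proper) (h : ∑ s, π.flux (Sum.inr s) ≠ 0) :
    ∃ a, 0 < ((M.J - M.P) *ᵥ π.dual) a := by
  by_contra! hne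
  simp only [J_sub_P_mulVec, sub_nonpos] at hne
  rw [sum_flux_inr hp] at h
  exact h (Finset.sum_eq_zero fun s _ => le_antisymm (nonpos_of_forall_le hreach hne s)
    (hp.dual_nonneg (maxprob_c_nonneg A) s))

/-- The actions of a policy of the subproblem at `y` remain tight after a dual update. -/
lemma exists_policy_update {y : σ → ℝ} {π : (M.subproblem y).Policy} (hp : π.Proper) (ε : ℝ) :
    ∃ π' : (M.subproblem (y + ε • π.dual)).Policy, π'.Proper ∧ π'.dual = π.dual := by
  have hex : ∀ s, ∃ b : M.tight (y + ε • π.dual) ⊕ σ,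
      (M.subproblem (y + ε • π.dual)).src b = s ∧
      (M.subproblem (y + ε • π.dual)).P b = (M.subproblem y).P (π.act s) ∧
      (M.subproblem (y + ε • π.dual)).c b = (M.subproblem y).c (π.act s) := by
    intro s
    have h1 := hp.dual_eq s
    have h2 := π.src_act s
    rcases hs : π.act s with a | t
    · rw [hs] at h1 h2
      have h2' : M.src a = s := h2
      -- A tight action used by `π` costs zero in the subproblem, so the policy equation says that
      -- the direction leaves its constraint unchanged.
      refine ⟨Sum.inl ⟨a, mem_tight_add a.2 ?_ ε⟩, h2, rfl, rfl⟩
      rw [J_sub_P_mulVec, h2', h1]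
      simp [maxprob]
    · rw [hs] at h2
      exact ⟨Sum.inr t, h2, rfl, rfl⟩
  choose b hb1 hb2 hb3 using hex
  let π' : (M.subproblem (y + ε • π.dual)).Policy := ⟨b, hb1⟩
  have ht : π'.transition = π.transition := by
    ext s t
    exact congrFun (hb2 s) t
  have hc : π'.actCost = π.actCost := funext hb3
  refine ⟨π', ?_, ?_⟩
  · rw [Policy.proper_iff, ht]
    exact π.proper_iff.1 hp
  · rw [Policy.dual, ht, hc, Policy.dual]

/-- The surviving policy bounds every new feasible `v` by `π.dual`. At a newly tight action violated
by `π.dual`, the new constraint lowers the sum by at least the violation. Positivity of `ε` plays no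
role. -/
lemma maxprobValue_update_lt [Fintype α] {y : σ → ℝ} {π : (M.subproblem y).Policy}
    (hp : π.Proper) (hopt : ¬ ∃ a, π.Improving a) {ε : ℝ} (hε : M.MaxStep y π.dual ε) :
    M.maxprobValue (M.tight (y + ε • π.dual)) < M.maxprobValue (M.tight y) := by
  classical
  rw [maxprobValue_eq (hp.optimal hopt).2]
  obtain ⟨π', hp', hd⟩ := exists_policy_update hp ε
  obtain ⟨a, ha, hpos⟩ := hε.exists_tight
  refine (maxprobValue_le (r := ∑ s, π.dual s - ((M.J - M.P) *ᵥ π.dual) a)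
    fun v hv => ?_).trans_lt (sub_lt_self _ hpos)
  have hle : ∀ s, v s ≤ π.dual s := fun s => hd ▸ hp'.le_dual hv s
  have h1 := (maxprob_dualFeasible_iff.1 hv).1 a ha
  have h2 : ∑ s, M.P a s * v s ≤ ∑ s, M.P a s * π.dual s :=
    Finset.sum_le_sum fun t _ => mul_le_mul_of_nonneg_left (hle t) (M.P_nonneg _ _)
  have h3 : π.dual (M.src a) - v (M.src a) ≤ ∑ s, (π.dual s - v s) :=
    Finset.single_le_sum (f := fun s => π.dual s - v s) (fun s _ => sub_nonneg.2 (hle s))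
      (Finset.mem_univ _)
  rw [Finset.sum_sub_distrib] at h3
  rw [J_sub_P_mulVec]
  linarith

/-! ### The final solution -/

/-- With no artificial flux the output is feasible for (P), and it is supported on tight actions,
which is complementary slackness with `y`. -/
lemma output_optimal [Fintype α] {y : σ → ℝ} (hy : M.DualFeasible y)
    {π : (M.subproblem y).Policy} (hp : π.Proper) (h : ∑ s, π.flux (Sum.inr s) = 0) :
    M.PrimalOptimal (M.output y π) ∧ M.DualOptimal y := by
  classical
  have hz : ∀ s, π.flux (Sum.inr s) = 0 := fun s =>
    (Finset.sum_eq_zero_iff_of_nonneg fun s _ => hp.flux_nonneg (Sum.inr s)).1 h s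
      (Finset.mem_univ s)
  have hsum : ∀ g : α → ℝ, ∑ a, g a * M.output y π a =
      ∑ a : M.tight y, g a * π.flux (Sum.inl a) := by
    intro g
    rw [← Finset.sum_subset (Finset.subset_univ (Finset.univ.filter (· ∈ M.tight y)))
      (fun a _ ha => by simp [output, (by simpa using ha : a ∉ M.tight y)]),
      Finset.sum_subtype (p := (· ∈ M.tight y)) _ (by simp)]
    refine Finset.sum_congr rfl fun a _ => ?_
    simp [output]
  have hx : M.PrimalFeasible (M.output y π) := by
    refine ⟨funext fun s => ?_, fun a => ?_⟩
    · have := congrFun hp.primalFeasible_flux.1 s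
      rw [← this]
      change ∑ a, (M.J - M.P) a s * M.output y π a =
        ∑ a, ((M.subproblem y).J - (M.subproblem y).P) a s * π.flux a
      rw [hsum fun a => (M.J - M.P) a s, Fintype.sum_sum_type]
      simp only [hz, mul_zero, Finset.sum_const_zero, add_zero]
      rfl
    · simp only [output]
      split_ifs
      · exact hp.flux_nonneg _
      · exact le_rfl
  refine optimal_of_eq hx hy ?_
  calc M.c ⬝ᵥ M.output y π = ((M.J - M.P) *ᵥ y) ⬝ᵥ M.output y π := by
        refine Finset.sum_congr rfl fun a _ => ?_
        by_cases ha : a ∈ M.tight y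
        · rw [show ((M.J - M.P) *ᵥ y) a = M.c a from ha]
        · simp [output, ha]
    _ = y ⬝ᵥ ((M.J - M.P)ᵀ *ᵥ M.output y π) := by rw [dotProduct_mulVec, vecMul_transpose]
    _ = ∑ s, y s := by rw [hx.1]; simp [dotProduct]

/-! ### The number of steps -/

/-- The number of action sets for which the subproblem has a smaller value. -/
def outerRank (M : SSP σ α) (y : σ → ℝ) : ℕ :=
  {B : Set α | M.maxprobValue B < M.maxprobValue (M.tight y)}.ncard

lemma outerRank_lt [Finite α] {y y' : σ → ℝ}
    (h : M.maxprobValue (M.tight y') < M.maxprobValue (M.tight y)) :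
    M.outerRank y' < M.outerRank y :=
  Set.ncard_lt_ncard ⟨fun _ hB => lt_trans hB h, fun hsub => by simpa using hsub h⟩
    (Set.toFinite _)

/-- The number of policies with a smaller sum of dual variables. -/
def innerRank {M : SSP σ α} (π : M.Policy) : ℕ :=
  {ρ : M.Policy | ∑ s, ρ.dual s < ∑ s, π.dual s}.ncard

lemma innerRank_lt [Finite α] {π π' : M.Policy} (h : ∑ s, π'.dual s < ∑ s, π.dual s) :
    innerRank π' < innerRank π :=
  have := Policy.finite_policy (M := M)
  Set.ncard_lt_ncard ⟨fun _ hB => lt_trans hB h, fun hsub => by simpa using hsub h⟩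
    (Set.toFinite _)

/-- Policies of all subproblems embed into the same set of maps, so the bound does not depend on the
tight set. -/
lemma innerRank_le [Finite α] {A : Set α} (π : (M.maxprob A).Policy) :
    innerRank π ≤ Nat.card (σ → α ⊕ σ) := by
  have := Policy.finite_policy (M := M.maxprob A)
  refine (Set.ncard_le_card _).trans (Nat.card_le_card_of_injective
    (fun ρ s => Sum.map Subtype.val id (ρ.act s)) fun ρ ρ' h => ?_)
  have : ρ.act = ρ'.act := funext fun s =>
    (Sum.map_injective.2 ⟨Subtype.val_injective, Function.injective_id⟩) (congrFun h s)
  cases ρ; cases ρ'; simpa using this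

/-- A bound on the number of the remaining steps. -/
def Config.bound {M : SSP σ α} : M.Config → ℕ
  -- The weight of a rank exceeds the largest offset within a round, so a drop of the outer rank
  -- pays for the whole next round.
  | .outer y => M.outerRank y * (Nat.card (σ → α ⊕ σ) + 3) + Nat.card (σ → α ⊕ σ) + 2
  | .inner y π => M.outerRank y * (Nat.card (σ → α ⊕ σ) + 3) + innerRank π + 1
  | .done _ _ => 0

/-! ### Dijkstra's algorithm -/

open Classical in
/-- The labelling of the states in `S` by `y`. -/
def labelOn (S : Set σ) (y : σ → ℝ) : σ → Option ℝ := fun s => if s ∈ S then some (y s) else none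

/-- The states connected to the target by tight actions. -/
def labelled (M : SSP σ α) (y : σ → ℝ) : Set σ := {s | (M.keep (M.tight y)).ReachesTarget s}

lemma labels_eq (y : σ → ℝ) : M.labels y = labelOn (M.labelled y) y := rfl

/-- The dual constraint of the arc is precisely this lower bound on its tentative label. -/
lemma tentative_le {y : σ → ℝ} (hy : M.DualFeasible y) {S : Set σ}
    {a : α} {v : ℝ} (h : M.Tentative (labelOn S y) a v) : M.src a ∉ S ∧ y (M.src a) ≤ v := by
  obtain ⟨h1, h2⟩ := h
  refine ⟨fun hs => by simp [labelOn, hs] at h1, ?_⟩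
  have hya := dualFeasible_iff.1 hy a
  rcases h2 with ⟨h0, rfl⟩ | ⟨t, d, ht, htd, rfl⟩
  · simpa [h0] using hya
  · have hd : d = y t := by
      by_cases hS : t ∈ S
      · simpa [labelOn, hS, eq_comm] using htd
      · simp [labelOn, hS] at htd
    rwa [sum_mul_of_eq_one ht, ← hd] at hya

/-- As long as some state connected to the target by tight actions is missing in `S`, a step of
Dijkstra's algorithm labels such a state. -/
lemma exists_dijkstraStep (hM : M.Deterministic) {y : σ → ℝ} (hy : M.DualFeasible y) {D : ℝ}
    {S : Set σ} (hD : ∀ s, s ∉ S → y s = D) (hne : ¬ M.labelled y ⊆ S) :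
    ∃ s ∈ M.labelled y, s ∉ S ∧ M.DijkstraStep (labelOn S y) (labelOn (insert s S) y) := by
  have hstep : ∀ a ∈ M.tight y, M.src a ∈ M.labelled y → M.src a ∉ S →
      M.Tentative (labelOn S y) a (y (M.src a)) →
      ∃ s ∈ M.labelled y, s ∉ S ∧ M.DijkstraStep (labelOn S y) (labelOn (insert s S) y) := by
    intro a ha hl hS ht
    refine ⟨M.src a, hl, hS, a, _, ht, fun b w hb => ?_, ?_⟩
    · obtain ⟨h1, h2⟩ := tentative_le hy hb
      rwa [hD _ hS, ← hD _ h1]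
    · funext t
      rcases eq_or_ne t (M.src a) with rfl | hts
      · simp [labelOn]
      · rw [Function.update_of_ne hts]
        by_cases htS : t ∈ S <;> simp [labelOn, hts, htS]
  by_contra hno
  refine hne fun s hs => ?_
  refine (keep_reaches_induct (A := M.tight y) (p := fun s => s ∈ M.labelled y ∧ s ∈ S) ?_ ?_ hs).2
  · intro a ha hlt
    have hl : M.src a ∈ M.labelled y := keep_reaches_of_lt ha hlt
    refine ⟨hl, not_not.1 fun hS => hno (hstep a ha hl hS ⟨by simp [labelOn, hS], Or.inl ?_⟩)⟩
    have h0 := hM.row_eq_zero hlt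
    exact ⟨h0, by simpa [h0] using mem_tight_iff.1 ha⟩
  · rintro a ha t hpos ⟨htl, htS⟩
    have hl : M.src a ∈ M.labelled y := keep_reaches_of_pos ha hpos htl
    refine ⟨hl, not_not.1 fun hS => hno (hstep a ha hl hS ⟨by simp [labelOn, hS], Or.inr
      ⟨t, y t, (hM a t).resolve_left hpos.ne', by simp [labelOn, htS], ?_⟩⟩)⟩
    rw [mem_tight_iff.1 ha, hM.sum_mul_of_pos hpos]

lemma dijkstra_extend (hM : M.Deterministic) {y : σ → ℝ} (hy : M.DualFeasible y) {D : ℝ}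
    {S : Set σ} (hD : ∀ s, s ∉ S → y s = D) (hS : S ⊆ M.labelled y) :
    Relation.ReflTransGen M.DijkstraStep (labelOn S y) (M.labels y) := by
  by_cases h : M.labelled y ⊆ S
  · rw [labels_eq, hS.antisymm h]
  · obtain ⟨s, hs, hsS, hstep⟩ := exists_dijkstraStep hM hy hD h
    have hlt : (insert s S)ᶜ.ncard < Sᶜ.ncard :=
      Set.ncard_lt_ncard (compl_lt_compl_iff_lt.2 (Set.ssubset_insert hsS)) (Set.toFinite _)
    exact .head hstep (dijkstra_extend hM hy
      (fun t ht => hD t fun h => ht (Set.mem_insert_of_mem s h)) (Set.insert_subset hs hS))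
termination_by Sᶜ.ncard

lemma dijkstra_extend_trans (hM : M.Deterministic) {y : σ → ℝ} (hy : M.DualFeasible y) {D : ℝ}
    {S : Set σ} (hD : ∀ s, s ∉ S → y s = D) (hS : S ⊆ M.labelled y) (hne : ¬ M.labelled y ⊆ S) :
    Relation.TransGen M.DijkstraStep (labelOn S y) (M.labels y) := by
  obtain ⟨s, hs, hsS, hstep⟩ := exists_dijkstraStep hM hy hD hne
  exact .head' hstep (dijkstra_extend hM hy
    (fun t ht => hD t fun h => ht (Set.mem_insert_of_mem s h)) (Set.insert_subset hs hS))

/-- The restricted dual constraints carry the value zero backwards from the target; determinism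
makes the single successor decide. -/
lemma dual_of_labelled (hM : M.Deterministic) {y : σ → ℝ} {π : (M.subproblem y).Policy}
    (hp : π.Proper) (hopt : ¬ ∃ a, π.Improving a) {s : σ} (hs : s ∈ M.labelled y) :
    π.dual s = 0 := by
  have hf := (maxprob_dualFeasible_iff.1 (Policy.dualFeasible_dual hopt)).1
  refine le_antisymm ?_ (hp.dual_nonneg (maxprob_c_nonneg _) s)
  refine keep_reaches_induct (A := M.tight y) (p := fun s => π.dual s ≤ 0)
    (fun a ha hlt => (hf a ha).trans ?_) (fun a ha t hpos ht => (hf a ha).trans ?_) hs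
  · simp [hM.row_eq_zero hlt]
  · rwa [hM.sum_mul_of_pos hpos]

lemma dual_of_not_labelled [Finite α] {y : σ → ℝ} {π : (M.subproblem y).Policy}
    (hp : π.Proper) (hopt : ¬ ∃ a, π.Improving a) {s : σ} (hs : s ∉ M.labelled y) :
    π.dual s = 1 := by
  classical
  have hf := (maxprob_dualFeasible_iff.1 (Policy.dualFeasible_dual hopt)).2
  refine le_antisymm (hf s) ?_
  -- Tight actions at unlabelled states lose no mass and lead only to unlabelled states; artificial
  -- actions give dual value 1. So `1 - π.dual`, cut off on labelled states, is a subsolution.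
  have := (π.proper_iff.1 hp).nonpos_of_le
    (v := fun s => if s ∈ M.labelled y then 0 else 1 - π.dual s) (fun s => ?_) s
  · simpa [hs] using this
  have hterm : ∀ t, 0 ≤ (if t ∈ M.labelled y then 0 else 1 - π.dual t) := fun t => by
    split_ifs
    · exact le_rfl
    · exact sub_nonneg.2 (hf t)
  by_cases hs : s ∈ M.labelled y
  · rw [if_pos hs]
    exact Finset.sum_nonneg fun t _ => mul_nonneg ((M.subproblem y).P_nonneg _ _) (hterm t)
  rw [if_neg hs]
  have h1 := hp.dual_eq s
  have h2 := π.src_act s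
  simp only [Policy.transition, of_apply]
  rcases ha : π.act s with a | t
  · rw [ha] at h1 h2
    have h2' : M.src a = s := h2
    have hrow : ∑ t, M.P a t = 1 := (M.P_row_le_one a).antisymm (not_lt.1 fun hlt =>
      hs (h2' ▸ keep_reaches_of_lt a.2 hlt))
    have h3 : ∀ t, M.P a t * (if t ∈ M.labelled y then 0 else 1 - π.dual t) =
        M.P a t * (1 - π.dual t) := by
      intro t
      split_ifs with ht
      · rcases (M.P_nonneg a t).eq_or_lt with h | h
        · simp [← h]
        · exact absurd (h2' ▸ keep_reaches_of_pos a.2 h ht) hs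
      · rfl
    change _ ≤ ∑ t, M.P a t * (if t ∈ M.labelled y then 0 else 1 - π.dual t)
    simp only [h3, mul_sub, mul_one, Finset.sum_sub_distrib, hrow]
    have h1' : π.dual s = 0 + ∑ t, M.P a t * π.dual t := h1
    linarith
  · rw [ha] at h1
    have h1' : π.dual s = 1 + ∑ t, 0 * π.dual t := h1
    refine le_trans ?_ (Finset.sum_nonneg fun t _ =>
      mul_nonneg ((M.subproblem y).P_nonneg _ _) (hterm t))
    simp [h1']

end

/-! ### Labels under a dual update, and the invariants of a run -/

section

variable {σ α : Type*} [Fintype σ] [DecidableEq σ] {M : SSP σ α}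

lemma labelled_update (hM : M.Deterministic) [Finite α] {y : σ → ℝ}
    {π : (M.subproblem y).Policy} (hp : π.Proper) (hopt : ¬ ∃ a, π.Improving a) (ε : ℝ) :
    M.labelled y ⊆ M.labelled (y + ε • π.dual) := by
  intro s hs
  refine (keep_reaches_induct (A := M.tight y)
    (p := fun s => s ∈ M.labelled y ∧ s ∈ M.labelled (y + ε • π.dual)) ?_ ?_ hs).2
  · intro a ha hlt
    have hl : M.src a ∈ M.labelled y := keep_reaches_of_lt ha hlt
    refine ⟨hl, keep_reaches_of_lt (mem_tight_add ha ?_ ε) hlt⟩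
    rw [J_sub_P_mulVec, dual_of_labelled hM hp hopt hl]
    simp [hM.row_eq_zero hlt]
  · rintro a ha t hpos ⟨htl, ht⟩
    have hl : M.src a ∈ M.labelled y := keep_reaches_of_pos ha hpos htl
    refine ⟨hl, keep_reaches_of_pos (mem_tight_add ha ?_ ε) hpos ht⟩
    rw [J_sub_P_mulVec, dual_of_labelled hM hp hopt hl, hM.sum_mul_of_pos hpos,
      dual_of_labelled hM hp hopt htl, sub_zero]

/-- The newly tight action starts at an unlabelled state, where the direction is 1. If it neither
lost mass nor entered a labelled state, the direction would average to 1 over its successors and its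
slope would vanish. -/
lemma exists_newly_labelled (hM : M.Deterministic) [Finite α] {y : σ → ℝ}
    {π : (M.subproblem y).Policy} (hp : π.Proper) (hopt : ¬ ∃ a, π.Improving a) {ε : ℝ}
    (hε : M.MaxStep y π.dual ε) : ¬ M.labelled (y + ε • π.dual) ⊆ M.labelled y := by
  obtain ⟨a, ha, hpos⟩ := hε.exists_tight
  rw [J_sub_P_mulVec, sub_pos] at hpos
  have hs : M.src a ∉ M.labelled y := fun hs => by
    rw [dual_of_labelled hM hp hopt hs] at hpos
    exact hpos.not_ge (Finset.sum_nonneg fun t _ =>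
      mul_nonneg (M.P_nonneg a t) (hp.dual_nonneg (maxprob_c_nonneg _) t))
  refine fun hsub => hs (hsub ?_)
  by_cases hlt : ∑ t, M.P a t < 1
  · exact keep_reaches_of_lt ha hlt
  · by_contra hno
    have h1 : ∀ t, M.P a t * π.dual t = M.P a t := fun t => by
      rcases (M.P_nonneg a t).eq_or_lt with h | h
      · simp [← h]
      · rw [dual_of_not_labelled hp hopt fun ht =>
          hno (keep_reaches_of_pos ha h (labelled_update hM hp hopt ε ht)), mul_one]
    rw [dual_of_not_labelled hp hopt hs] at hpos
    simp only [h1] at hpos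
    exact hlt hpos

/-- All states which are not connected to the target by tight actions have the same dual value. -/
def ConstantOff (M : SSP σ α) (y : σ → ℝ) : Prop :=
  ∃ D, ∀ s, s ∉ M.labelled y → y s = D

lemma labelOn_update (hM : M.Deterministic) {y : σ → ℝ} {π : (M.subproblem y).Policy}
    (hp : π.Proper) (hopt : ¬ ∃ a, π.Improving a) (ε : ℝ) :
    labelOn (M.labelled y) (y + ε • π.dual) = M.labels y := by
  rw [labels_eq]
  funext s
  by_cases hs : s ∈ M.labelled y
  · simp [labelOn, hs, dual_of_labelled hM hp hopt hs]
  · simp [labelOn, hs]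

lemma update_eq_of_not_labelled [Finite α] {y : σ → ℝ} {π : (M.subproblem y).Policy}
    (hp : π.Proper) (hopt : ¬ ∃ a, π.Improving a) (ε : ℝ) {D : ℝ}
    (hD : ∀ s, s ∉ M.labelled y → y s = D) :
    ∀ s, s ∉ M.labelled y → (y + ε • π.dual) s = D + ε := fun s hs => by
  simp [hD s hs, dual_of_not_labelled hp hopt hs]

/-! ### The invariants of the primal-dual algorithm -/

/-- The invariants of the configurations reached by the primal-dual algorithm. -/
def Config.Valid {M : SSP σ α} : M.Config → Prop
  | .outer y => M.DualFeasible y ∧ (M.Deterministic → M.ConstantOff y)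
  | .inner y π => M.DualFeasible y ∧ (M.Deterministic → M.ConstantOff y) ∧ π.Proper
  | .done y π => M.DualFeasible y ∧ π.Proper ∧ (¬ ∃ a, π.Improving a) ∧
      ∑ s, π.flux (Sum.inr s) = 0

lemma dualFeasible_zero (hc : ∀ a, 0 ≤ M.c a) : M.DualFeasible 0 :=
  dualFeasible_iff.2 (by simpa using hc)

lemma Config.Valid.step [Finite α] {method : PIMethod} {z z' : M.Config} (hz : z.Valid)
    (h : M.PDStep method z z') : z'.Valid := by
  cases h with
  | start y π hp => exact ⟨hz.1, hz.2, hp⟩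
  | improve y π π' h =>
    exact ⟨hz.1, hz.2.1, hz.2.2.switch (maxprob_c_nonneg _) (.of_step h)⟩
  | finish y π hopt h0 => exact ⟨hz.1, hz.2.2, hopt, h0⟩
  | update y π ε hopt h0 hε =>
    refine ⟨hε.1.2, fun hM => ?_⟩
    obtain ⟨D, hD⟩ := hz.2.1 hM
    exact ⟨D + ε, fun s hs => update_eq_of_not_labelled hz.2.2 hopt ε hD s
      fun h => hs (labelled_update hM hz.2.2 hopt ε h)⟩

lemma Reached.valid [Finite α] (hc : ∀ a, 0 ≤ M.c a) {method : PIMethod} {z : M.Config}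
    (h : M.Reached method z) : z.Valid := by
  induction h with
  | refl => exact ⟨dualFeasible_zero hc, fun _ => ⟨0, fun _ _ => rfl⟩⟩
  | tail _ h ih => exact ih.step h

lemma Config.Valid.bound_lt [Fintype α] {method : PIMethod} {z z' : M.Config} (hz : z.Valid)
    (h : M.PDStep method z z') : z'.bound < z.bound := by
  cases h with
  | start y π hp =>
    have := innerRank_le π
    simp only [Config.bound]
    omega
  | improve y π π' h =>
    have := innerRank_lt (hz.2.2.sum_dual_lt (maxprob_c_nonneg _) (.of_step h))
    simp only [Config.bound]
    omega
  | finish y π hopt h0 => simp [Config.bound]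
  | update y π ε hopt h0 hε =>
    have h1 := outerRank_lt (maxprobValue_update_lt hz.2.2 hopt hε)
    have h2 := Nat.mul_le_mul_right (Nat.card (σ → α ⊕ σ) + 3) h1
    rw [Nat.succ_mul] at h2
    simp only [Config.bound]
    omega

lemma Config.Valid.progress [Finite α] (hreach : ∀ s, M.ReachesTarget s) (method : PIMethod)
    {z : M.Config} (hz : z.Valid) :
    (∃ y π, z = .done y π) ∨ ∃ z', M.PDStep method z z' := by
  cases z with
  | outer y => exact Or.inr ⟨_, .start y (M.artificial _) (artificial_proper _)⟩
  | inner y π =>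
    refine Or.inr ?_
    by_cases hi : ∃ a, π.Improving a
    · obtain ⟨π', h⟩ := Policy.exists_step method hi
      exact ⟨_, .improve y π π' h⟩
    by_cases h0 : ∑ s, π.flux (Sum.inr s) = 0
    · exact ⟨_, .finish y π hi h0⟩
    · obtain ⟨ε, hε⟩ := exists_maxStep hz.1 (dual_direction hreach hz.2.2 h0)
      exact ⟨_, .update y π ε hi h0 hε⟩
  | done y π => exact Or.inl ⟨y, π, rfl⟩

end

end SSP

end

theorem mainTheorem7 {σ α : Type*} [Fintype σ] [DecidableEq σ] [Fintype α]
    (M : SSP σ α)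
    (hreach : ∀ s, M.ReachesTarget s)
    (hc : ∀ a, 0 ≤ M.c a)
    (method : SSP.PIMethod) :
    -- the algorithm can be initialized with the dual solution 0
    M.DualFeasible 0 ∧
    -- it terminates: the number of steps of its runs is bounded
    (∃ N : ℕ, ∀ (k : ℕ) (r : ℕ → M.Config), r 0 = .outer 0 →
      (∀ i < k, M.PDStep method (r i) (r (i + 1))) → k ≤ N) ∧
    -- it never gets stuck before the final configuration
    (∀ z, M.Reached method z → (∃ y π, z = .done y π) ∨ ∃ z', M.PDStep method z z') ∧
    -- all dual solutions are feasible, policy iteration runs over proper policies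
    -- and indeed solves the subproblems
    (∀ y, M.Reached method (.outer y) → M.DualFeasible y) ∧
    (∀ y π, M.Reached method (.inner y π) →
      π.Proper ∧ ((¬ ∃ a, π.Improving a) → M.SolvesSubproblem y π)) ∧
    -- the final solutions are optimal
    (∀ y π, M.Reached method (.done y π) →
      M.PrimalOptimal (M.output y π) ∧ M.DualOptimal y) ∧
    -- on deterministic instances the algorithm is Dijkstra's algorithm
    (M.Deterministic →
      Relation.ReflTransGen M.DijkstraStep (fun _ => none) (M.labels 0) ∧
      (∀ y π y', M.Reached method (.inner y π) → M.PDStep method (.inner y π) (.outer y') →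
        Relation.TransGen M.DijkstraStep (M.labels y) (M.labels y')) ∧
      (∀ y π, M.Reached method (.done y π) → M.labels y = fun s => some (y s))) := by

  refine ⟨SSP.dualFeasible_zero hc, ⟨(SSP.Config.outer 0 : M.Config).bound, ?_⟩,
    fun z hz => (SSP.Reached.valid hc hz).progress hreach method,
    fun y hy => (SSP.Reached.valid hc hy).1, fun y π h => ?_, fun y π h => ?_,
    fun hM => ⟨?_, fun y π y' h hstep => ?_, fun y π h => ?_⟩⟩
  · intro k r h0 hr
    -- Each step costs at least one unit of `bound`, so the initial bound limits the length of the
    -- run.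
    have key : ∀ i ≤ k, M.Reached method (r i) ∧
        (r i).bound + i ≤ (SSP.Config.outer 0 : M.Config).bound := by
      intro i
      induction i with
      | zero => exact fun _ => by rw [h0]; exact ⟨.refl, le_rfl⟩
      | succ i ih =>
        intro hi
        obtain ⟨h1, h2⟩ := ih (by omega)
        have h3 := (SSP.Reached.valid hc h1).bound_lt (hr i hi)
        exact ⟨h1.tail (hr i hi), by omega⟩
    exact (Nat.le_add_left _ _).trans (key k le_rfl).2
  · have hp := (SSP.Reached.valid hc h).2.2
    classical
    refine ⟨hp, fun hopt => ?_⟩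
    unfold SSP.SolvesSubproblem
    convert hp.optimal hopt
  · obtain ⟨hy, hp, -, hz⟩ := SSP.Reached.valid hc h
    exact SSP.output_optimal hy hp hz
  · have := SSP.dijkstra_extend hM (SSP.dualFeasible_zero hc) (S := ∅) (D := 0)
      (fun _ _ => rfl) (Set.empty_subset _)
    rwa [show SSP.labelOn ∅ (0 : σ → ℝ) = fun _ => none from funext fun s => by simp [SSP.labelOn]]
      at this
  · obtain ⟨-, hD, hp⟩ := SSP.Reached.valid hc h
    obtain ⟨D, hD⟩ := hD hM
    cases hstep with
    | update _ _ ε hopt h0 hε =>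
      -- The old labels are also the values of the updated dual on the old labelled set, so all
      -- Dijkstra steps can be made with the updated dual alone.
      rw [← SSP.labelOn_update hM hp hopt ε]
      exact SSP.dijkstra_extend_trans hM hε.1.2
        (SSP.update_eq_of_not_labelled hp hopt ε hD) (SSP.labelled_update hM hp hopt ε)
        (SSP.exists_newly_labelled hM hp hopt hε)
  · obtain ⟨hy, hp, hopt, hz⟩ := SSP.Reached.valid hc h
    -- Zero cost makes the subproblem dual vanish, whereas an unlabelled state would have value 1.
    have hl : ∀ s, s ∈ M.labelled y := fun s => by
      by_contra hs
      have h1 := SSP.dual_of_not_labelled hp hopt hs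
      rw [SSP.dual_eq_zero hp hz s] at h1
      exact zero_ne_one h1
    funext s
    exact if_pos (hl s)
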